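/- There is an absolute constant $C>0$ such that the following holds. Let $X$ be a set, and let $h:X\to(0,1)$ be a random function drawn from a $4$-wise independent hash family with range $(0,1)$; that is, each $h(x)$ is uniformly distributed on $(0,1)$, and for any at most four distinct points $x\in X$ the values $h(x)$ are mutually independent. Let $e_1,\dots,e_n\in X$ be elements with fixed (non-random) real priorities $w(e_1)>w(e_2)>\dots>w(e_n)$ (so $e_i$ is the element of rank $i$, for instance the $i$-th most frequent element with its frequency as priority); no assumption is made on how the rank order relates to $X$. Put $s_i=h(e_i)$. Consider the learned Treap on the remapped keys: the binary tree whose nodes are the pairs $(s_j,w(e_j))$, $1\le j\le n$, that is a binary search tree with respect to the keys $s_j$ and in which no node has a larger priority than any of its ancestors (almost surely the $s_j$ are distinct, and this tree is then unique). Let the depth of a node be the number of nodes on the path from the root to it, so that the root has depth $1$. Then for every $1\le i\le n$, $$\mathbb{E}[\text{depth of } s_i]\le 1+C\log i .$$ In particular, the expected depth of $s_i$ is $O(\log i)$ for $i\ge 2$, with a constant independent of $n$, $X$, the elements, the priorities and the hash family. -/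

import Mathlib

open MeasureTheory ProbabilityTheory

/-- A binary tree whose nodes carry pairs `(key, priority)`. -/
abbrev PTree : Type := BinaryTree (ℝ × ℝ)

namespace PTree

/-- `a` is the label `(key, priority)` of some node of the tree. -/
def HasNode (a : ℝ × ℝ) : PTree → Prop
  | .nil => False
  | .node b l r => a = b ∨ HasNode a l ∨ HasNode a r

/-- A treap: at every node, the keys of the left subtree are smaller and those of the right
subtree are larger than the key of the node (search order), and no descendant has a larger
priority (heap order). -/
def IsTreap : PTree → Prop
  | .nil => True
  | .node b l r =>
      (∀ a, HasNode a l → a.1 < b.1 ∧ a.2 ≤ b.2) ∧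
      (∀ a, HasNode a r → b.1 < a.1 ∧ a.2 ≤ b.2) ∧
      IsTreap l ∧ IsTreap r

/-- The number of nodes visited by the search for the key `x`. If `x` is a key of a search tree,
this is the depth of its node, the root having depth `1`. -/
noncomputable def depth (x : ℝ) : PTree → ℕ
  | .nil => 0
  | .node b l r => if x = b.1 then 1 else if x < b.1 then depth x l + 1 else depth x r + 1

end PTree

/-- A random function `h : X → (0, 1)`, drawn according to `μ`, is `k`-wise independent: each value
is uniform on `(0, 1)` and the values at any at most `k` distinct points are independent. -/
structure IsKWiseIndependentHash {Ω X : Type*} [MeasurableSpace Ω] (k : ℕ) (μ : Measure Ω)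
    (h : Ω → X → ℝ) : Prop where
  mem_Ioo : ∀ ω x, h ω x ∈ Set.Ioo (0 : ℝ) 1
  measurable : ∀ x, Measurable fun ω => h ω x
  uniform : ∀ x, pdf.IsUniform (fun ω => h ω x) (Set.Ioo (0 : ℝ) 1) μ volume
  indep : ∀ S : Finset X, S.card ≤ k → iIndepFun (fun (x : S) ω => h ω x) μ

/-- `t` is a learned treap for the elements `e 0, e 1, …` with priorities `w`, where each element
`e j` is stored under the remapped key `g (e j)`: it is a treap whose nodes are exactly the
pairs `(g (e j), w (e j))`. -/
def IsLearnedTreap {X : Type*} {n : ℕ} (e : Fin n → X) (w g : X → ℝ) (t : PTree) : Prop :=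
  PTree.IsTreap t ∧ ∀ a, PTree.HasNode a t ↔ ∃ j, a = (g (e j), w (e j))

/-!
The depth of `e i` counts the `j` such that no element of higher priority than `e j` has its key
between those of `e j` and `e i`. Such a `j` is at most `i`, and if `j < i`, then `e j` is closer
to `e i` than all the elements before it, in one of the two directions around the circle `ℝ / ℤ`:
it is a record of the sequence of circular distances to the right or to the left of `h (e i)`.
Conditionally on `h (e i)`, these distances are uniform on `(0, 1)` and 3-wise independent, so it
suffices that a 3-wise independent uniform sequence `Y 0, …, Y (N - 1)` has `O(log N)` records in
expectation.

Consider the indices from `m = 32 ^ k` to `32 * m`, which contain `O(1)` records. On average `O(1)`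
of them have a value below `1 / m`. Split the remaining values into the scales `[v, 32 * v)` with
`v = 32 ^ s / m`. A record there needs the first `m` values to avoid `(0, v)`, which by
Chebyshev's inequality has probability at most `1 / (m * v) = 32 ^ (-s)`. Divide the range of
indices and the range of values into `L` intervals each. Since the records decrease, they meet at
most `2 * L` of the `L ^ 2` boxes of the grid, so there are at most `4 * L` of them, up to the
number of triples of points in a common box. That number is controlled by 3-wise independence, and
`L = 32 * 16 ^ s` makes the total summable in `s`.
-/

/-! ### Search paths in treaps -/

/-- The nodes of a treap with node set `A` that the search for the key `x` visits: those whose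
priority is maximal among the nodes with keys between their own key and `x`. -/
def searchPath {α β : Type*} [Lattice α] [LE β] (A : Set (α × β)) (x : α) : Set (α × β) :=
  {a ∈ A | ∀ c ∈ A, c.1 ∈ Set.uIcc a.1 x → c.2 ≤ a.2}

lemma searchPath_eq_insert {α β : Type*} [Lattice α] [Preorder β] {A S : Set (α × β)} {x : α}
    {b : α × β} (hb : b ∈ A) (hmax : ∀ a ∈ A, a ≠ b → a.2 < b.2) (hSA : S ⊆ A)
    (hS : ∀ a ∈ S, ∀ c ∈ A, c.1 ∈ Set.uIcc a.1 x → c ∈ S)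
    (hSc : ∀ a ∈ A, a ∉ S → b.1 ∈ Set.uIcc a.1 x) :
    searchPath A x = insert b (searchPath S x) := by
  ext a
  constructor
  · rintro ⟨haA, ha⟩
    by_cases haS : a ∈ S
    · exact Or.inr ⟨haS, fun c hc => ha c (hSA hc)⟩
    · by_contra hab
      exact (hmax a haA fun h => hab (Or.inl h)).not_ge (ha b hb (hSc a haA haS))
  · rintro (rfl | ⟨haS, ha⟩)
    · exact ⟨hb, fun c hc _ => (eq_or_ne c a).elim (fun h => h ▸ le_rfl) fun h => (hmax c hc h).le⟩
    · exact ⟨hSA haS, fun c hc hcx => ha c (hS a haS c hc hcx) hcx⟩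

namespace PTree

/-- The set of labels of the nodes of a tree. -/
def nodes (t : PTree) : Set (ℝ × ℝ) := {a | HasNode a t}

variable {b : ℝ × ℝ} {l r t : PTree} {x : ℝ}

lemma nodes_nil : nodes .nil = ∅ := rfl

lemma finite_nodes : ∀ t : PTree, (nodes t).Finite
  | .nil => Set.finite_empty
  | .node b l r => ((finite_nodes l).union (finite_nodes r)).insert b

lemma IsTreap.snd_lt_root (ht : IsTreap (.node b l r))
    (hinj : Set.InjOn Prod.snd (nodes (.node b l r))) :
    ∀ a ∈ nodes (.node b l r), a ≠ b → a.2 < b.2 := by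
  intro a ha hab
  refine lt_of_le_of_ne ?_ fun h => hab (hinj ha (Or.inl rfl) h)
  rcases ha with rfl | ha | ha
  exacts [le_rfl, (ht.1 a ha).2, (ht.2.1 a ha).2]

lemma IsTreap.searchPath_of_lt (ht : IsTreap (.node b l r))
    (hinj : Set.InjOn Prod.snd (nodes (.node b l r))) (hx : x < b.1) :
    searchPath (nodes (.node b l r)) x = insert b (searchPath (nodes l) x) := by
  refine searchPath_eq_insert (Or.inl rfl) (ht.snd_lt_root hinj) (fun a ha => Or.inr (Or.inl ha))
    (fun a ha c hc hcx => ?_) fun a ha hal => ?_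
  · have hcb : c.1 < b.1 := hcx.2.trans_lt (max_lt (ht.1 a ha).1 hx)
    rcases hc with rfl | hc | hc
    exacts [absurd hcb (lt_irrefl _), hc, absurd hcb (ht.2.1 c hc).1.not_gt]
  · rcases ha with rfl | ha | ha
    exacts [Set.left_mem_uIcc, absurd ha hal, Set.mem_uIcc.2 (Or.inr ⟨hx.le, (ht.2.1 a ha).1.le⟩)]

lemma IsTreap.searchPath_of_gt (ht : IsTreap (.node b l r))
    (hinj : Set.InjOn Prod.snd (nodes (.node b l r))) (hx : b.1 < x) :
    searchPath (nodes (.node b l r)) x = insert b (searchPath (nodes r) x) := by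
  refine searchPath_eq_insert (Or.inl rfl) (ht.snd_lt_root hinj) (fun a ha => Or.inr (Or.inr ha))
    (fun a ha c hc hcx => ?_) fun a ha har => ?_
  · have hbc : b.1 < c.1 := (lt_min (ht.2.1 a ha).1 hx).trans_le hcx.1
    rcases hc with rfl | hc | hc
    exacts [absurd hbc (lt_irrefl _), absurd hbc (ht.1 c hc).1.not_gt, hc]
  · rcases ha with rfl | ha | ha
    exacts [Set.left_mem_uIcc, Set.mem_uIcc.2 (Or.inl ⟨(ht.1 a ha).1.le, hx.le⟩), absurd ha har]

lemma IsTreap.searchPath_root (ht : IsTreap (.node b l r))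
    (hinj : Set.InjOn Prod.snd (nodes (.node b l r))) :
    searchPath (nodes (.node b l r)) b.1 = {b} := by
  rw [searchPath_eq_insert (S := ∅) (Or.inl rfl) (ht.snd_lt_root hinj) (Set.empty_subset _)
    (fun a ha => absurd ha (Set.notMem_empty a)) fun a _ _ => Set.right_mem_uIcc]
  simp [searchPath]

theorem IsTreap.depth_eq_ncard_searchPath (ht : IsTreap t) (hinj : Set.InjOn Prod.snd (nodes t))
    (hx : x ∈ Prod.fst '' nodes t) : depth x t = (searchPath (nodes t) x).ncard := by
  have ncard_insert : ∀ {b s}, b ∉ nodes s →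
      (insert b (searchPath (nodes s) x)).ncard = (searchPath (nodes s) x).ncard + 1 :=
    fun hb => Set.ncard_insert_of_notMem (fun h => hb h.1) ((finite_nodes _).subset fun _ h => h.1)
  induction t with
  | nil => simp only [nodes_nil, Set.image_empty, Set.mem_empty_iff_false] at hx
  | node b l r ihl ihr =>
    obtain ⟨hl, hr, htl, htr⟩ := id ht
    rcases lt_trichotomy x b.1 with hlt | rfl | hgt
    · have hxl : x ∈ Prod.fst '' nodes l := by
        obtain ⟨a, rfl | h | h, rfl⟩ := hx
        exacts [absurd hlt (lt_irrefl _), ⟨a, h, rfl⟩, absurd hlt (hr a h).1.not_gt]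
      have hbl : b ∉ nodes l := fun h => lt_irrefl _ (hl b h).1
      rw [ht.searchPath_of_lt hinj hlt, ncard_insert hbl,
        ← ihl htl (hinj.mono fun _ h => Or.inr (Or.inl h)) hxl]
      simp [depth, hlt.ne, hlt]
    · simp [depth, ht.searchPath_root hinj]
    · have hxr : x ∈ Prod.fst '' nodes r := by
        obtain ⟨a, rfl | h | h, rfl⟩ := hx
        exacts [absurd hgt (lt_irrefl _), absurd hgt (hl a h).1.not_gt, ⟨a, h, rfl⟩]
      have hbr : b ∉ nodes r := fun h => lt_irrefl _ (hr b h).1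
      rw [ht.searchPath_of_gt hinj hgt, ncard_insert hbr,
        ← ihr htr (hinj.mono fun _ h => Or.inr (Or.inr h)) hxr]
      simp [depth, hgt.ne', hgt.le]

end PTree

/-- The event that `e j` is stored at an ancestor of the node of `e i`, or at that node itself, in
the learned treap for the remapped keys `g`, as a condition on the keys and priorities alone. -/
def IsTreapAncestor {X ι : Type*} (e : ι → X) (w g : X → ℝ) (i j : ι) : Prop :=
  ∀ k, g (e k) ∈ Set.uIcc (g (e j)) (g (e i)) → w (e k) ≤ w (e j)

open Classical in
lemma IsLearnedTreap.depth_eq {X : Type*} {n : ℕ} {e : Fin n → X} {w g : X → ℝ} {t : PTree}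
    (ht : IsLearnedTreap e w g t) (hw : Function.Injective fun j => w (e j)) (i : Fin n) :
    PTree.depth (g (e i)) t = (Finset.univ.filter (IsTreapAncestor e w g i)).card := by
  have hnodes : PTree.nodes t = Set.range fun j => (g (e j), w (e j)) := by
    ext a
    exact (ht.2 a).trans (exists_congr fun j => eq_comm)
  have hinj : Set.InjOn Prod.snd (PTree.nodes t) := by
    rw [hnodes]
    rintro _ ⟨j, rfl⟩ _ ⟨k, rfl⟩ hjk
    rw [hw hjk]
  have hpath : searchPath (PTree.nodes t) (g (e i)) =
      (fun j => (g (e j), w (e j))) '' {j | IsTreapAncestor e w g i j} := by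
    ext a
    simp only [searchPath, hnodes, IsTreapAncestor]
    aesop
  rw [ht.1.depth_eq_ncard_searchPath hinj (hnodes ▸ ⟨_, ⟨i, rfl⟩, rfl⟩), hpath,
    Set.ncard_image_of_injective _ fun j k h => hw (congrArg Prod.snd h), ← Set.ncard_coe_finset]
  simp

/-! ### `k`-wise independence -/

/-- The random variables `Y i` all have distribution `ν`, and any at most `k` of them are
independent. -/
structure IsKWiseIndep {Ω ι E : Type*} [MeasurableSpace Ω] [MeasurableSpace E] (k : ℕ)
    (Y : ι → Ω → E) (ν : Measure E) (μ : Measure Ω) : Prop where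
  measurable : ∀ i, Measurable (Y i)
  map_eq : ∀ i, μ.map (Y i) = ν
  indep : ∀ S : Finset ι, S.card ≤ k → iIndepFun (fun i : S => Y i) μ

namespace IsKWiseIndep

variable {Ω ι E : Type*} [MeasurableSpace Ω] [MeasurableSpace E] {k : ℕ} {Y : ι → Ω → E}
  {ν : Measure E} {μ : Measure Ω}

lemma reindex (hY : IsKWiseIndep k Y ν μ) {κ : Type*} (f : κ ↪ ι) :
    IsKWiseIndep k (fun a => Y (f a)) ν μ where
  measurable a := hY.measurable (f a)
  map_eq a := hY.map_eq (f a)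
  indep S hS := (hY.indep (S.map f) (by rwa [Finset.card_map])).precomp
    (g := fun a : S => ⟨f a, Finset.mem_map_of_mem f a.2⟩)
    fun a b hab => Subtype.ext (f.injective (congrArg Subtype.val hab))

lemma mono (hY : IsKWiseIndep k Y ν μ) {l : ℕ} (hl : l ≤ k) : IsKWiseIndep l Y ν μ where
  measurable := hY.measurable
  map_eq := hY.map_eq
  indep S hS := hY.indep S (hS.trans hl)

lemma measureReal_preimage (hY : IsKWiseIndep k Y ν μ) (i : ι) {A : Set E}
    (hA : MeasurableSet A) : μ.real (Y i ⁻¹' A) = ν.real A := by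
  rw [← hY.map_eq i, map_measureReal_apply (hY.measurable i) hA]

lemma measureReal_forall_mem (hY : IsKWiseIndep k Y ν μ) {S : Finset ι} (hS : S.card ≤ k)
    {A : Set E} (hA : MeasurableSet A) :
    μ.real {ω | ∀ i ∈ S, Y i ω ∈ A} = ν.real A ^ S.card := by
  have hset : {ω | ∀ i ∈ S, Y i ω ∈ A} = ⋂ i ∈ (Finset.univ : Finset S), Y i ⁻¹' A := by
    ext ω
    simp
  rw [hset, measureReal_def, (hY.indep S hS).measure_inter_preimage_eq_mul Finset.univ
    (sets := fun _ => A) fun _ _ => hA, ENNReal.toReal_prod]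
  simp_rw [← measureReal_def, hY.measureReal_preimage _ hA]
  simp

lemma indepFun (hY : IsKWiseIndep 2 Y ν μ) {i j : ι} (hij : i ≠ j) : IndepFun (Y i) (Y j) μ := by
  classical
  exact (hY.indep {i, j} (Finset.card_pair hij).le).indepFun
    (i := ⟨i, by simp⟩) (j := ⟨j, by simp⟩) fun h => hij (congrArg Subtype.val h)

lemma measurePreserving_prodMk [IsProbabilityMeasure μ] {Y : Option ι → Ω → E}
    (hY : IsKWiseIndep (k + 1) Y ν μ) {S : Finset ι} (hS : S.card ≤ k) :
    MeasurePreserving (fun ω => (Y none ω, fun i : S => Y (some i) ω)) μ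
      (ν.prod (Measure.pi fun _ => ν)) := by
  have : IsProbabilityMeasure ν :=
    hY.map_eq none ▸ Measure.isProbabilityMeasure_map (hY.measurable none).aemeasurable
  have hind : iIndepFun (fun o : Option S => Y (o.map (↑))) μ :=
    (hY.indep S.insertNone (by simpa using hS)).precomp
      (g := fun o : Option S => ⟨o.map (↑), by cases o <;> simp⟩)
      fun o p h => Option.map_injective Subtype.val_injective (congrArg Subtype.val h)
  have hpi : MeasurePreserving (fun ω (o : Option S) => Y (o.map (↑)) ω) μ
      (Measure.pi fun _ => ν) := by
    refine ⟨measurable_pi_lambda _ fun o => hY.measurable _, ?_⟩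
    rw [hind.map_fun_eq_pi_map fun o => (hY.measurable _).aemeasurable]
    simp only [hY.map_eq]
  have hsplit : MeasurePreserving (MeasurableEquiv.piOptionEquivProd fun _ : Option S => E)
      (Measure.pi fun _ => ν) ((Measure.pi fun _ => ν).prod ν) :=
    MeasurePreserving.symm (MeasurableEquiv.piOptionEquivProd fun _ : Option S => E).symm
      ⟨MeasurableEquiv.measurable _, Measure.pi_map_piOptionEquivProd fun _ => ν⟩
  exact Measure.measurePreserving_swap.comp (hsplit.comp hpi)

/-- Conditionally on `Y none`, any `k` of the new variables are independent, and their joint law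
does not depend on `Y none`: it is also the unconditional one. -/
lemma comp_pivot [IsProbabilityMeasure μ] {Y : Option ι → Ω → E} (hY : IsKWiseIndep (k + 1) Y ν μ)
    (hk : 1 ≤ k) {F : Type*} [MeasurableSpace F] {ρ : Measure F} [IsProbabilityMeasure ρ]
    {g : E → E → F} (hg : Measurable (Function.uncurry g))
    (hgν : ∀ u, MeasurePreserving (g u) ν ρ) :
    IsKWiseIndep k (fun i ω => g (Y none ω) (Y (some i) ω)) ρ μ := by
  have : IsProbabilityMeasure ν :=
    hY.map_eq none ▸ Measure.isProbabilityMeasure_map (hY.measurable none).aemeasurable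
  have hlaw {S : Finset ι} (hS : S.card ≤ k) :
      MeasurePreserving (fun ω => fun i : S => g (Y none ω) (Y (some i) ω)) μ
        (Measure.pi fun _ => ρ) := by
    have hskew := (MeasurePreserving.id ν).skew_product (g := fun u (v : S → E) i => g u (v i))
      (μc := Measure.pi fun _ => ν) (μd := Measure.pi fun _ => ρ)
      (measurable_pi_lambda _ fun i =>
        hg.comp (measurable_fst.prodMk ((measurable_pi_apply i).comp measurable_snd)))
      (.of_forall fun u => (measurePreserving_pi _ _ fun _ => hgν u).map_eq)
    exact measurePreserving_snd.comp (hskew.comp (hY.measurePreserving_prodMk hS))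
  have hmap (i : ι) : MeasurePreserving (fun ω => g (Y none ω) (Y (some i) ω)) μ ρ :=
    (measurePreserving_eval (fun _ => ρ) (⟨i, Finset.mem_singleton_self i⟩ : ({i} : Finset ι))).comp
      (hlaw (by simpa using hk))
  refine ⟨fun i => (hmap i).measurable, fun i => (hmap i).map_eq, fun S hS => ?_⟩
  refine (iIndepFun_iff_map_fun_eq_pi_map fun i : S => (hmap i).measurable.aemeasurable).2 ?_
  simp only [(hlaw hS).map_eq, (hmap _).map_eq]

end IsKWiseIndep

/-! ### Rotations of the unit interval -/

lemma measurePreserving_coe_unitAddCircle :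
    MeasurePreserving ((↑) : ℝ → UnitAddCircle) (volume.restrict (Set.Ioo 0 1)) volume := by
  simpa [restrict_Ioo_eq_restrict_Ioc] using UnitAddCircle.measurePreserving_mk 0

lemma measurePreserving_equivIco_unitAddCircle :
    MeasurePreserving (fun z : UnitAddCircle => (AddCircle.equivIco 1 0 z : ℝ)) volume
      (volume.restrict (Set.Ioo 0 1)) := by
  have hm : Measurable fun z : UnitAddCircle => (AddCircle.equivIco 1 0 z : ℝ) :=
    measurable_subtype_coe.comp (AddCircle.measurableEquivIco 1 0).measurable
  have hcoe := measurePreserving_coe_unitAddCircle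
  refine ⟨hm, ?_⟩
  rw [← hcoe.map_eq, Measure.map_map hm hcoe.measurable]
  refine (Measure.map_congr ?_).trans Measure.map_id
  filter_upwards [ae_restrict_mem measurableSet_Ioo] with v hv
  simp [AddCircle.coe_equivIco_mk_apply, Int.fract_eq_self.2 ⟨hv.1.le, hv.2⟩]

lemma measurePreserving_fract_of_coe {f : ℝ → ℝ} {φ : UnitAddCircle → UnitAddCircle}
    (hφ : MeasurePreserving φ) (hf : ∀ v : ℝ, φ v = f v) :
    MeasurePreserving (fun v => Int.fract (f v)) (volume.restrict (Set.Ioo 0 1))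
      (volume.restrict (Set.Ioo 0 1)) := by
  convert measurePreserving_equivIco_unitAddCircle.comp
    (hφ.comp measurePreserving_coe_unitAddCircle) using 2 with v
  rw [Function.comp_apply, Function.comp_apply, hf, AddCircle.coe_equivIco_mk_apply, div_one,
    mul_one]

lemma measurePreserving_fract_sub_right (u : ℝ) :
    MeasurePreserving (fun v => Int.fract (v - u)) (volume.restrict (Set.Ioo 0 1))
      (volume.restrict (Set.Ioo 0 1)) :=
  measurePreserving_fract_of_coe (measurePreserving_sub_right volume (u : UnitAddCircle))
    fun _ => rfl

lemma measurePreserving_fract_sub_left (u : ℝ) :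
    MeasurePreserving (fun v => Int.fract (u - v)) (volume.restrict (Set.Ioo 0 1))
      (volume.restrict (Set.Ioo 0 1)) :=
  measurePreserving_fract_of_coe (Measure.measurePreserving_sub_left volume (u : UnitAddCircle))
    fun _ => rfl

lemma IsKWiseIndependentHash.isKWiseIndep {Ω X : Type*} [MeasurableSpace Ω] {μ : Measure Ω}
    {h : Ω → X → ℝ} {k : ℕ} (hh : IsKWiseIndependentHash k μ h) :
    IsKWiseIndep k (fun x ω => h ω x) (volume.restrict (Set.Ioo 0 1)) μ where
  measurable := hh.measurable
  map_eq x := by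
    rw [show μ.map (fun ω => h ω x) = _ from hh.uniform x, ProbabilityTheory.cond]
    simp
  indep := hh.indep

/-! ### Counting events -/

lemma choose_card_filter {ι : Type*} (s : Finset ι) (p : ι → Prop) [DecidablePred p] (r : ℕ)
    [DecidablePred fun T : Finset ι => ∀ j ∈ T, p j] :
    (s.filter p).card.choose r = ((s.powersetCard r).filter fun T => ∀ j ∈ T, p j).card := by
  rw [← Finset.card_powersetCard]
  congr 1
  ext T
  simp only [Finset.mem_powersetCard, Finset.mem_filter, Finset.subset_iff, forall₂_and]
  tauto

lemma cast_card_filter_eq_sum_indicator {Ω ι : Type*} (s : Finset ι) (p : ι → Ω → Prop)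
    [∀ ω, DecidablePred fun j => p j ω] :
    (fun ω => ((s.filter fun j => p j ω).card : ℝ)) =
      fun ω => ∑ j ∈ s, {ω | p j ω}.indicator 1 ω := by
  ext ω
  simp [Set.indicator_apply]

section Counting

variable {Ω ι : Type*} [MeasurableSpace Ω] {μ : Measure Ω} [IsFiniteMeasure μ]

lemma integrable_card_filter (s : Finset ι) {p : ι → Ω → Prop}
    [∀ ω, DecidablePred fun j => p j ω] (hp : ∀ j ∈ s, MeasurableSet {ω | p j ω}) :
    Integrable (fun ω => ((s.filter fun j => p j ω).card : ℝ)) μ := by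
  rw [cast_card_filter_eq_sum_indicator]
  exact integrable_finsetSum _ fun j hj => (integrable_const 1).indicator (hp j hj)

lemma integral_card_filter (s : Finset ι) {p : ι → Ω → Prop}
    [∀ ω, DecidablePred fun j => p j ω] (hp : ∀ j ∈ s, MeasurableSet {ω | p j ω}) :
    ∫ ω, ((s.filter fun j => p j ω).card : ℝ) ∂μ = ∑ j ∈ s, μ.real {ω | p j ω} := by
  rw [cast_card_filter_eq_sum_indicator,
    integral_finsetSum _ fun j hj => (integrable_const 1).indicator (hp j hj)]
  exact Finset.sum_congr rfl fun j hj => integral_indicator_one (hp j hj)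

end Counting

lemma variance_indicator_one_le {Ω : Type*} [MeasurableSpace Ω] {μ : Measure Ω}
    [IsProbabilityMeasure μ] {S : Set Ω} (hS : MeasurableSet S) :
    variance (S.indicator 1) μ ≤ μ.real S := by
  refine (variance_le_expectation_sq
    (aestronglyMeasurable_const.indicator hS : AEStronglyMeasurable (S.indicator 1) μ)).trans_eq ?_
  rw [← integral_indicator_one hS]
  congr 1
  ext ω
  by_cases hω : ω ∈ S <;> simp [hω]

lemma IsKWiseIndep.measureReal_forall_notMem_le {Ω ι E : Type*} [MeasurableSpace Ω]
    [MeasurableSpace E] {Y : ι → Ω → E} {ν : Measure E} {μ : Measure Ω} [IsProbabilityMeasure μ]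
    (hY : IsKWiseIndep 2 Y ν μ) {s : Finset ι} (hs : s.Nonempty) {A : Set E}
    (hA : MeasurableSet A) (hνA : 0 < ν.real A) :
    μ.real {ω | ∀ j ∈ s, Y j ω ∉ A} ≤ 1 / (s.card * ν.real A) := by
  set Z : ι → Ω → ℝ := fun j => (Y j ⁻¹' A).indicator 1 with hZ
  have hYA (j : ι) : MeasurableSet (Y j ⁻¹' A) := hY.measurable j hA
  have hZm (j : ι) : MemLp (Z j) 2 μ := memLp_indicator_const 2 (hYA j) 1 (Or.inr (by finiteness))
  have hmean (j : ι) : μ[Z j] = ν.real A := by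
    rw [hZ, integral_indicator_one (hYA j), hY.measureReal_preimage j hA]
  have hvar (j : ι) : variance (Z j) μ ≤ ν.real A :=
    (variance_indicator_one_le (hYA j)).trans_eq (hY.measureReal_preimage j hA)
  have hvarsum : variance (∑ j ∈ s, Z j) μ ≤ s.card * ν.real A := by
    rw [IndepFun.variance_sum fun j _ => hZm j]
    · exact (Finset.sum_le_card_nsmul s _ _ fun j _ => hvar j).trans_eq (nsmul_eq_mul _ _)
    · exact fun i _ j _ hij => (hY.indepFun hij).comp (measurable_one.indicator hA)
        (measurable_one.indicator hA)
  have hpos : 0 < s.card * ν.real A := mul_pos (by exact_mod_cast hs.card_pos) hνA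
  have hmeansum : μ[∑ j ∈ s, Z j] = s.card * ν.real A := by
    simp [integral_finsetSum _ fun j _ => (hZm j).integrable one_le_two, hmean]
  have hsub : {ω | ∀ j ∈ s, Y j ω ∉ A} ⊆
      {ω | s.card * ν.real A ≤ |(∑ j ∈ s, Z j) ω - μ[∑ j ∈ s, Z j]|} := by
    intro ω hω
    have hzero : (∑ j ∈ s, Z j) ω = 0 := by
      rw [Finset.sum_apply]
      exact Finset.sum_eq_zero fun j hj =>
        Set.indicator_of_notMem (s := Y j ⁻¹' A) (hω j hj) 1
    rw [Set.mem_ofPred_eq, hzero, hmeansum, zero_sub, abs_neg, abs_of_pos hpos]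
  calc μ.real {ω | ∀ j ∈ s, Y j ω ∉ A}
      ≤ variance (∑ j ∈ s, Z j) μ / (s.card * ν.real A) ^ 2 :=
        ENNReal.toReal_le_of_le_ofReal (div_nonneg (variance_nonneg _ _) (sq_nonneg _))
          ((measure_mono hsub).trans
            (meas_ge_le_variance_div_sq (memLp_finsetSum' s fun j _ => hZm j) hpos))
    _ ≤ s.card * ν.real A / (s.card * ν.real A) ^ 2 := by gcongr
    _ = 1 / (s.card * ν.real A) := by field_simp

/-! ### Records of 3-wise independent sequences -/

lemma IsKWiseIndep.integral_choose_card_filter {Ω ι E : Type*} [MeasurableSpace Ω]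
    [MeasurableSpace E] {k : ℕ} {Y : ι → Ω → E} {ν : Measure E} {μ : Measure Ω}
    [IsFiniteMeasure μ] (hY : IsKWiseIndep k Y ν μ) (s : Finset ι) {A : Set E}
    [DecidablePred (· ∈ A)] (hA : MeasurableSet A) {r : ℕ} (hr : r ≤ k) :
    Integrable (fun ω => ((s.filter fun j => Y j ω ∈ A).card.choose r : ℝ)) μ ∧
      ∫ ω, ((s.filter fun j => Y j ω ∈ A).card.choose r : ℝ) ∂μ =
        s.card.choose r * ν.real A ^ r := by
  classical
  have hmeas : ∀ T ∈ s.powersetCard r, MeasurableSet {ω | ∀ j ∈ T, Y j ω ∈ A} := fun T _ => by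
    simp only [Set.ofPred_forall]
    exact T.measurableSet_biInter fun j _ => hY.measurable j hA
  simp only [choose_card_filter]
  refine ⟨integrable_card_filter _ hmeas, ?_⟩
  rw [integral_card_filter _ hmeas, ← Finset.card_powersetCard, ← nsmul_eq_mul]
  refine Finset.sum_eq_card_nsmul fun T hT => ?_
  have hTr : T.card = r := (Finset.mem_powersetCard.1 hT).2
  rw [hY.measureReal_forall_mem (hTr.trans_le hr) hA, hTr]

lemma card_image_prodMk_le {ι : Type*} [LinearOrder ι] {s : Finset ι} {f g : ι → ℕ} {a b : ℕ}
    (hf : MonotoneOn f s) (hg : AntitoneOn g s) (hfa : ∀ j ∈ s, f j < a) (hgb : ∀ j ∈ s, g j < b) :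
    (s.image fun j => (f j, g j)).card ≤ a + b := by
  rw [← Finset.card_range (a + b)]
  refine Finset.card_le_card_of_injOn (fun p => p.1 + (b - p.2)) ?_ ?_
  · simp only [Finset.coe_image, Set.MapsTo, Set.forall_mem_image, Finset.coe_range, Set.mem_Iio]
    intro j hj
    have := hfa j hj
    lia
  · simp only [Set.InjOn, Finset.coe_image, Set.forall_mem_image, Prod.mk.injEq]
    intro j hj k hk hjk
    have := hgb j hj
    have := hgb k hk
    rcases le_total j k with h | h
    · have := hf hj hk h
      have := hg hj hk h
      lia
    · have := hf hk hj h
      have := hg hk hj h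
      lia

lemma le_two_add_choose_three (c : ℕ) : c ≤ 2 + c.choose 3 := by
  induction c with
  | zero => exact Nat.zero_le _
  | succ c ih =>
    rcases lt_or_ge c 2 with hc | hc
    · lia
    · have := Nat.choose_pos hc
      have := Nat.choose_succ_succ c 2
      lia

/-- The index pairs of the elements form a staircase, so only `a + b` of them occur. -/
lemma card_le_add_sum_choose_three {ι : Type*} [LinearOrder ι] {s : Finset ι} {f g : ι → ℕ}
    {a b : ℕ} (hf : MonotoneOn f s) (hg : AntitoneOn g s) (hfa : ∀ j ∈ s, f j < a)
    (hgb : ∀ j ∈ s, g j < b) :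
    s.card ≤ 2 * (a + b) + ∑ p ∈ Finset.range a ×ˢ Finset.range b,
      (s.filter fun j => (f j, g j) = p).card.choose 3 := by
  have hsub : (s.image fun j => (f j, g j)) ⊆ Finset.range a ×ˢ Finset.range b := by
    simp only [Finset.image_subset_iff, Finset.mem_product, Finset.mem_range]
    exact fun j hj => ⟨hfa j hj, hgb j hj⟩
  calc s.card = ∑ p ∈ s.image fun j => (f j, g j), (s.filter fun j => (f j, g j) = p).card :=
        Finset.card_eq_sum_card_image _ s
    _ ≤ ∑ p ∈ s.image fun j => (f j, g j),
          (2 + (s.filter fun j => (f j, g j) = p).card.choose 3) :=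
        Finset.sum_le_sum fun p _ => le_two_add_choose_three _
    _ ≤ _ := by
        rw [Finset.sum_add_distrib, Finset.sum_const, smul_eq_mul, mul_comm]
        gcongr
        exact card_image_prodMk_le hf hg hfa hgb

/-- The index `j` is a record, or running minimum, of the sequence `y`. -/
def IsRecord {ι α : Type*} [LT ι] [LE α] (y : ι → α) (j : ι) : Prop := ∀ k < j, y j ≤ y k

open Classical in
lemma card_isRecord_le {N : ℕ} (y : Fin N → ℝ) (J : Finset (Fin N)) {q L : ℕ} {v δ : ℝ}
    (hJ : ∀ j ∈ J, (j : ℕ) < L * q) (hv : 0 ≤ v) (hδ : 0 < δ) :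
    (J.filter fun j => IsRecord y j ∧ y j ∈ Set.Ico v (L * δ)).card ≤ 4 * L +
      ∑ p ∈ Finset.range L ×ˢ Finset.range L,
        ((J.filter fun j : Fin N => (j : ℕ) / q = p.1).filter fun j =>
          y j ∈ Set.Ico (p.2 * δ) ((p.2 + 1) * δ)).card.choose 3 := by
  set s := J.filter fun j => IsRecord y j ∧ y j ∈ Set.Ico v (L * δ)
  have hfloor {j : Fin N} (hj : j ∈ s) : 0 ≤ y j / δ :=
    div_nonneg (hv.trans (Finset.mem_filter.1 hj).2.2.1) hδ.le
  have hgrid := card_le_add_sum_choose_three (s := s) (f := fun j : Fin N => (j : ℕ) / q)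
    (g := fun j => ⌊y j / δ⌋₊) (a := L) (b := L) (fun j _ k _ hjk => Nat.div_le_div_right hjk)
    (fun j _ k hk hjk => ?_) (fun j hj => ?_) fun j hj => ?_
  · refine hgrid.trans (add_le_add (by lia) (Finset.sum_le_sum fun p _ => ?_))
    refine Nat.choose_le_choose 3 (Finset.card_le_card fun j hj => ?_)
    obtain ⟨hjs, rfl⟩ := Finset.mem_filter.1 hj
    refine Finset.mem_filter.2 ⟨Finset.mem_filter.2 ⟨(Finset.mem_filter.1 hjs).1, rfl⟩, ?_, ?_⟩
    · exact (le_div_iff₀ hδ).1 (Nat.floor_le (hfloor hjs))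
    · exact (div_lt_iff₀ hδ).1 (Nat.lt_floor_add_one _)
  · rcases hjk.eq_or_lt with rfl | hjk
    · exact le_rfl
    · exact Nat.floor_le_floor (by gcongr; exact (Finset.mem_filter.1 hk).2.1 j hjk)
  · exact Nat.div_lt_of_lt_mul (by rw [mul_comm]; exact hJ j (Finset.mem_filter.1 hj).1)
  · exact (Nat.floor_lt (hfloor hj)).2 ((div_lt_iff₀ hδ).2 (Finset.mem_filter.1 hj).2.2.2)

open Classical in
/-- A value in `(0, v)` among the first `m` rules out all later records above `v`. -/
lemma card_isRecord_le_indicator {N : ℕ} (y : Fin N → ℝ) {J : Finset (Fin N)} {m q L : ℕ} {v δ : ℝ}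
    (hJ : ∀ j ∈ J, m ≤ (j : ℕ) + 1 ∧ (j : ℕ) < L * q) (hv : 0 < v) (hδ : 0 < δ) :
    ((J.filter fun j => IsRecord y j ∧ y j ∈ Set.Ico v (L * δ)).card : ℝ) ≤
      4 * L * {y : Fin N → ℝ | ∀ k : Fin N, (k : ℕ) < m → y k ∉ Set.Ioo 0 v}.indicator 1 y +
      ∑ p ∈ Finset.range L ×ˢ Finset.range L,
        (((J.filter fun j : Fin N => (j : ℕ) / q = p.1).filter fun j =>
          y j ∈ Set.Ico (p.2 * δ) ((p.2 + 1) * δ)).card.choose 3 : ℝ) := by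
  by_cases hy : y ∈ {y : Fin N → ℝ | ∀ k : Fin N, (k : ℕ) < m → y k ∉ Set.Ioo 0 v}
  · rw [Set.indicator_of_mem hy, Pi.one_apply, mul_one]
    exact_mod_cast card_isRecord_le y J (fun j hj => (hJ j hj).2) hv.le hδ
  · rw [Set.indicator_of_notMem hy, mul_zero, zero_add]
    obtain ⟨k, hkm, hk⟩ : ∃ k : Fin N, (k : ℕ) < m ∧ y k ∈ Set.Ioo 0 v := by simpa using hy
    have hnone : ∀ j ∈ J, ¬(IsRecord y j ∧ y j ∈ Set.Ico v (L * δ)) := by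
      rintro j hj ⟨hrec, hvj, -⟩
      have hkj : k ≤ j := Nat.lt_succ_iff.1 (hkm.trans_le (hJ j hj).1)
      have hjk : y j ≤ y k := hkj.eq_or_lt.elim (fun h => h ▸ le_rfl) (hrec k)
      exact (hvj.trans hjk).not_gt hk.2
    rw [Finset.filter_false_of_mem hnone, Finset.card_empty, Nat.cast_zero]
    positivity

lemma measurableSet_isRecord {Ω ι : Type*} [MeasurableSpace Ω] [LT ι] [Countable ι]
    {Y : ι → Ω → ℝ} (hY : ∀ j, Measurable (Y j)) (j : ι) :
    MeasurableSet {ω | IsRecord (fun k => Y k ω) j} := by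
  simp only [IsRecord, Set.ofPred_forall]
  exact .iInter fun k => .iInter fun _ => measurableSet_le (hY j) (hY k)

lemma card_filter_div_eq_le {N q : ℕ} (J : Finset (Fin N)) (hq : 0 < q) (a : ℕ) :
    (J.filter fun j : Fin N => (j : ℕ) / q = a).card ≤ q := by
  have hq' : (Finset.Ico (a * q) (a * q + q)).card = q := by simp
  refine (Finset.card_le_card_of_injOn Fin.val (fun j hj => ?_)
    Fin.val_injective.injOn).trans_eq hq'
  obtain ⟨hge, hlt⟩ := (Nat.div_eq_iff hq).1 (Finset.mem_filter.1 hj).2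
  exact Finset.mem_coe.2 (Finset.mem_Ico.2 ⟨by lia, by lia⟩)

lemma IsKWiseIndep.measureReal_preimage_compl_Ico {Ω ι : Type*} [MeasurableSpace Ω]
    {μ : Measure Ω} {k : ℕ} {Y : ι → Ω → ℝ} {v : ℝ}
    (hY : IsKWiseIndep k Y (volume.restrict (Set.Ioo 0 1)) μ) (hv : 0 ≤ v) (hv1 : v ≤ 1) (j : ι) :
    μ.real (Y j ⁻¹' (Set.Ico v 1)ᶜ) = v := by
  have hcompl : (Set.Ico v 1)ᶜ ∩ Set.Ioo 0 1 = Set.Ioo 0 v := by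
    ext y
    simp only [Set.mem_inter_iff, Set.mem_compl_iff, Set.mem_Ico, Set.mem_Ioo]
    grind
  rw [hY.measureReal_preimage j measurableSet_Ico.compl,
    measureReal_restrict_apply measurableSet_Ico.compl, hcompl,
    Real.volume_real_Ioo_of_le hv, sub_zero]

section UniformRecords

variable {Ω : Type*} [MeasurableSpace Ω] {μ : Measure Ω} [IsProbabilityMeasure μ] {N : ℕ}
  {Y : Fin N → Ω → ℝ} {J : Finset (Fin N)} {m q L : ℕ} {v δ : ℝ}

lemma measureReal_forall_notMem_Ioo_le (hY : IsKWiseIndep 2 Y (volume.restrict (Set.Ioo 0 1)) μ)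
    (hm : 0 < m) (hmN : m ≤ N) (hv : 0 < v) (hv1 : v ≤ 1) :
    μ.real {ω | ∀ k : Fin N, (k : ℕ) < m → Y k ω ∉ Set.Ioo 0 v} ≤ 1 / (m * v) := by
  have hK : (Finset.univ.filter fun k : Fin N => (k : ℕ) < m).card = m := by
    rw [Fin.card_filter_val_lt, min_eq_right hmN]
  have hvol : (volume.restrict (Set.Ioo (0 : ℝ) 1)).real (Set.Ioo 0 v) = v := by
    rw [measureReal_restrict_apply measurableSet_Ioo,
      Set.inter_eq_left.2 (Set.Ioo_subset_Ioo_right hv1), Real.volume_real_Ioo_of_le hv.le,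
      sub_zero]
  have := hY.measureReal_forall_notMem_le (Finset.card_pos.1 (hK ▸ hm)) measurableSet_Ioo
    (hvol ▸ hv)
  simpa only [hK, hvol, Finset.mem_filter, Finset.mem_univ, true_and] using this

lemma integral_choose_card_box_le (hY : IsKWiseIndep 3 Y (volume.restrict (Set.Ioo 0 1)) μ)
    (J : Finset (Fin N)) (hq : 0 < q) (hδ : 0 ≤ δ) (a b : ℕ) :
    ∫ ω, (((J.filter fun j : Fin N => (j : ℕ) / q = a).filter fun j =>
      Y j ω ∈ Set.Ico (b * δ) ((b + 1) * δ)).card.choose 3 : ℝ) ∂μ ≤ (q * δ) ^ 3 := by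
  rw [(hY.integral_choose_card_filter _ measurableSet_Ico le_rfl).2, mul_pow]
  gcongr
  · exact_mod_cast (Nat.choose_le_pow _ _).trans
      (Nat.pow_le_pow_left (card_filter_div_eq_le J hq a) 3)
  · calc (volume.restrict (Set.Ioo (0 : ℝ) 1)).real (Set.Ico (b * δ) ((b + 1) * δ))
        = volume.real (Set.Ico (b * δ) ((b + 1) * δ) ∩ Set.Ioo 0 1) :=
          measureReal_restrict_apply measurableSet_Ico
      _ ≤ volume.real (Set.Ico (b * δ) ((b + 1) * δ)) :=
          measureReal_mono Set.inter_subset_left measure_Ico_lt_top.ne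
      _ = δ := by
          rw [Real.volume_real_Ico_of_le (by gcongr; linarith)]
          ring

lemma sum_measureReal_isRecord_Ico_le
    (hY : IsKWiseIndep 3 Y (volume.restrict (Set.Ioo 0 1)) μ) (hm : 0 < m) (hmN : m ≤ N)
    (hq : 0 < q) (hJ : ∀ j ∈ J, m ≤ (j : ℕ) + 1 ∧ (j : ℕ) < L * q) (hv : 0 < v) (hv1 : v ≤ 1)
    (hδ : 0 < δ) :
    ∑ j ∈ J, μ.real {ω | IsRecord (fun k => Y k ω) j ∧ Y j ω ∈ Set.Ico v (L * δ)} ≤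
      4 * L / (m * v) + L ^ 2 * (q * δ) ^ 3 := by
  classical
  set H := {ω | ∀ k : Fin N, (k : ℕ) < m → Y k ω ∉ Set.Ioo 0 v} with hH
  have hHm : MeasurableSet H := by
    simp only [hH, Set.ofPred_forall]
    exact .iInter fun k => .iInter fun _ => (hY.measurable k measurableSet_Ioo).compl
  have hHint : Integrable (H.indicator 1 : Ω → ℝ) μ := (integrable_const 1).indicator hHm
  let c (p : ℕ × ℕ) (ω : Ω) : ℕ := ((J.filter fun j : Fin N => (j : ℕ) / q = p.1).filter
    fun j => Y j ω ∈ Set.Ico (p.2 * δ) ((p.2 + 1) * δ)).card.choose 3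
  have hc (p : ℕ × ℕ) : Integrable (fun ω => (c p ω : ℝ)) μ :=
    (hY.integral_choose_card_filter _ measurableSet_Ico le_rfl).1
  have hcsum := integrable_finsetSum (Finset.range L ×ˢ Finset.range L) fun p _ => hc p
  have hrec : ∀ j ∈ J, MeasurableSet
      {ω | IsRecord (fun k => Y k ω) j ∧ Y j ω ∈ Set.Ico v (L * δ)} := fun j _ =>
    (measurableSet_isRecord hY.measurable j).inter (hY.measurable j measurableSet_Ico)
  rw [← integral_card_filter J hrec]
  calc _ ≤ ∫ ω, 4 * L * H.indicator 1 ω +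
          ∑ p ∈ Finset.range L ×ˢ Finset.range L, (c p ω : ℝ) ∂μ :=
        integral_mono (integrable_card_filter J hrec) ((hHint.const_mul _).add hcsum) fun ω =>
          card_isRecord_le_indicator (fun k => Y k ω) hJ hv hδ
    _ = 4 * L * μ.real H + ∑ p ∈ Finset.range L ×ˢ Finset.range L, ∫ ω, (c p ω : ℝ) ∂μ := by
        rw [integral_add (hHint.const_mul _) hcsum, integral_const_mul,
          integral_indicator_one hHm, integral_finsetSum _ fun p _ => hc p]
    _ ≤ 4 * L * (1 / (m * v)) + ∑ p ∈ Finset.range L ×ˢ Finset.range L, (q * δ) ^ 3 := by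
        gcongr with p
        · exact measureReal_forall_notMem_Ioo_le (hY.mono (by norm_num)) hm hmN hv hv1
        · exact integral_choose_card_box_le hY J hq hδ.le p.1 p.2
    _ = 4 * L / (m * v) + L ^ 2 * (q * δ) ^ 3 := by
        simp only [Finset.sum_const, Finset.card_product, Finset.card_range, nsmul_eq_mul]
        push_cast
        ring

/-- The grid has `32 * 16 ^ s` cells per side, a compromise that makes both terms of
`sum_measureReal_isRecord_Ico_le` decay like `2 ^ (-s)`. -/
lemma sum_measureReal_isRecord_scale_le
    (hY : IsKWiseIndep 3 Y (volume.restrict (Set.Ioo 0 1)) μ) {k s : ℕ} (hs : s ≤ k)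
    (hkN : 32 ^ k ≤ N) (hJ : ∀ j ∈ J, 32 ^ k ≤ (j : ℕ) + 1 ∧ (j : ℕ) < 32 ^ (k + 1)) :
    ∑ j ∈ J, μ.real {ω | IsRecord (fun i => Y i ω) j ∧
      Y j ω ∈ Set.Ico (32 ^ s / 32 ^ k) (32 ^ (s + 1) / 32 ^ k)} ≤ 1152 * (1 / 2) ^ s := by
  obtain ⟨d, rfl⟩ := Nat.exists_eq_add_of_le hs
  have h16 : (16 : ℝ) ^ s = (2 ^ s) ^ 4 := by rw [← pow_mul, mul_comm, pow_mul]; norm_num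
  have h32 : (32 : ℝ) ^ s = (2 ^ s) ^ 5 := by rw [← pow_mul, mul_comm, pow_mul]; norm_num
  have hLq : 32 * 16 ^ s * (2 ^ s * 32 ^ d) = 32 ^ (s + d + 1) := by
    rw [pow_succ, pow_add, show 32 ^ s = 16 ^ s * 2 ^ s from mul_pow 16 2 s]
    ring
  have hLδ : ((32 * 16 ^ s : ℕ) : ℝ) * (2 ^ s / 32 ^ (s + d)) = 32 ^ (s + 1) / 32 ^ (s + d) := by
    push_cast
    rw [pow_succ, h16, h32]
    ring
  have hv1 : (32 : ℝ) ^ s / 32 ^ (s + d) ≤ 1 :=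
    div_le_one_of_le₀ (pow_le_pow_right₀ (by norm_num) hs) (by positivity)
  have h := sum_measureReal_isRecord_Ico_le (m := 32 ^ (s + d)) (q := 2 ^ s * 32 ^ d)
    (L := 32 * 16 ^ s) (v := 32 ^ s / 32 ^ (s + d)) (δ := 2 ^ s / 32 ^ (s + d)) hY (by positivity)
    hkN (by positivity) (by rwa [hLq]) (by positivity) hv1 (by positivity)
  rw [hLδ] at h
  refine h.trans_eq ?_
  push_cast
  rw [pow_add, h16, h32, one_div, inv_pow]
  field_simp
  ring

lemma measureReal_isRecord_le (hY : IsKWiseIndep 1 Y (volume.restrict (Set.Ioo 0 1)) μ)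
    (k : ℕ) (j : Fin N) :
    μ.real {ω | IsRecord (fun i => Y i ω) j} ≤ 1 / 32 ^ k +
      ∑ s ∈ Finset.range k, μ.real {ω | IsRecord (fun i => Y i ω) j ∧
        Y j ω ∈ Set.Ico (32 ^ s / 32 ^ k) (32 ^ (s + 1) / 32 ^ k)} := by
  rw [← hY.measureReal_preimage_compl_Ico (v := 1 / 32 ^ k) (by positivity)
    (div_le_one_of_le₀ (one_le_pow₀ (by norm_num)) (by positivity)) j]
  refine (measureReal_mono fun ω hω => ?_).trans ((measureReal_union_le _ _).trans
    (add_le_add_right (measureReal_biUnion_finset_le _ _) _))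
  by_cases hyj : Y j ω ∈ Set.Ico (1 / 32 ^ k) 1
  · obtain ⟨s, hs, hs'⟩ := exists_nat_pow_near ((div_le_iff₀ (by positivity)).1 hyj.1)
      (by norm_num : (1 : ℝ) < 32)
    have hsk : (32 : ℝ) ^ s < 32 ^ k := hs.trans_lt (mul_lt_of_lt_one_left (by positivity) hyj.2)
    exact Or.inr (Set.mem_biUnion
      (Finset.mem_coe.2 (Finset.mem_range.2 ((pow_lt_pow_iff_right₀ (by norm_num)).1 hsk)))
      ⟨hω, (div_le_iff₀ (by positivity)).2 hs, (lt_div_iff₀ (by positivity)).2 hs'⟩)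
  · exact Or.inl hyj

lemma sum_measureReal_isRecord_block_le
    (hY : IsKWiseIndep 3 Y (volume.restrict (Set.Ioo 0 1)) μ) (k : ℕ)
    (hJ : ∀ j ∈ J, 32 ^ k ≤ (j : ℕ) + 1 ∧ (j : ℕ) < 32 ^ (k + 1)) :
    ∑ j ∈ J, μ.real {ω | IsRecord (fun i => Y i ω) j} ≤ 2336 := by
  rcases J.eq_empty_or_nonempty with rfl | ⟨j₀, hj₀⟩
  · simp
  have hkN : 32 ^ k ≤ N := (hJ j₀ hj₀).1.trans j₀.2
  have hcard : (J.card : ℝ) ≤ 32 ^ (k + 1) := by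
    have hJcard := Finset.card_le_card_of_injOn (s := J) (t := Finset.range (32 ^ (k + 1))) Fin.val
      (fun j hj => Finset.mem_coe.2 (Finset.mem_range.2 (hJ j hj).2)) Fin.val_injective.injOn
    rw [Finset.card_range] at hJcard
    exact_mod_cast hJcard
  calc ∑ j ∈ J, μ.real {ω | IsRecord (fun i => Y i ω) j}
      ≤ ∑ j ∈ J, (1 / 32 ^ k + ∑ s ∈ Finset.range k, μ.real {ω | IsRecord (fun i => Y i ω) j ∧
          Y j ω ∈ Set.Ico (32 ^ s / 32 ^ k) (32 ^ (s + 1) / 32 ^ k)}) :=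
        Finset.sum_le_sum fun j _ => measureReal_isRecord_le (hY.mono (by norm_num)) k j
    _ = J.card / 32 ^ k + ∑ s ∈ Finset.range k, ∑ j ∈ J, μ.real {ω | IsRecord (fun i => Y i ω) j ∧
          Y j ω ∈ Set.Ico (32 ^ s / 32 ^ k) (32 ^ (s + 1) / 32 ^ k)} := by
        rw [Finset.sum_add_distrib, Finset.sum_comm, Finset.sum_const, nsmul_eq_mul, mul_one_div]
    _ ≤ 32 ^ (k + 1) / 32 ^ k + ∑ s ∈ Finset.range k, 1152 * (1 / 2) ^ s := by
        gcongr with s hs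
        exact sum_measureReal_isRecord_scale_le hY (Finset.mem_range.1 hs).le hkN hJ
    _ ≤ 32 + 1152 * 2 := by
        rw [← Finset.mul_sum, pow_succ', mul_div_cancel_right₀ _ (by positivity)]
        gcongr
        exact sum_geometric_two_le k
    _ = 2336 := by norm_num

theorem sum_measureReal_isRecord_le
    (hY : IsKWiseIndep 3 Y (volume.restrict (Set.Ioo 0 1)) μ) :
    ∑ j, μ.real {ω | IsRecord (fun k => Y k ω) j} ≤ 4672 * Real.logb 2 (N + 1) := by
  rcases N.eq_zero_or_pos with rfl | hN
  · simp
  have hlog : Nat.log 32 N ≤ Real.logb 2 (N + 1) := calc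
    (Nat.log 32 N : ℝ) ≤ Nat.log 2 (N + 1) := by
      exact_mod_cast Nat.log_mono (by norm_num) (by norm_num) N.le_succ
    _ ≤ Real.logb 2 (N + 1) := by exact_mod_cast Real.natLog_le_logb (N + 1) 2
  have hone : 1 ≤ Real.logb 2 (N + 1) := by
    rw [Real.le_logb_iff_rpow_le (by norm_num) (by positivity), Real.rpow_one]
    exact_mod_cast Nat.succ_le_succ hN
  have hmaps : ∀ j ∈ (Finset.univ : Finset (Fin N)),
      Nat.log 32 ((j : ℕ) + 1) ∈ Finset.range (Nat.log 32 N + 1) := fun j _ =>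
    Finset.mem_range_succ_iff.2 (Nat.log_mono_right j.2)
  calc ∑ j, μ.real {ω | IsRecord (fun k => Y k ω) j}
      = ∑ k ∈ Finset.range (Nat.log 32 N + 1),
          ∑ j ∈ Finset.univ.filter fun j : Fin N => Nat.log 32 ((j : ℕ) + 1) = k,
            μ.real {ω | IsRecord (fun k => Y k ω) j} :=
        (Finset.sum_fiberwise_of_maps_to hmaps _).symm
    _ ≤ ∑ _k ∈ Finset.range (Nat.log 32 N + 1), (2336 : ℝ) := by
        refine Finset.sum_le_sum fun k _ => sum_measureReal_isRecord_block_le hY k fun j hj => ?_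
        obtain ⟨-, rfl⟩ := Finset.mem_filter.1 hj
        exact ⟨Nat.pow_log_le_self 32 (Nat.succ_ne_zero _),
          (Nat.lt_succ_self _).trans (Nat.lt_pow_succ_log_self (by norm_num) _)⟩
    _ = 2336 * (Nat.log 32 N + 1) := by simp [mul_comm]
    _ ≤ 4672 * Real.logb 2 (N + 1) := by linarith

end UniformRecords

/-! ### Ancestors as records -/

lemma IsRecord.comp_strictMono {ι κ α : Type*} [Preorder ι] [Preorder κ] [LE α] {y : ι → α}
    {f : κ → ι} (hf : StrictMono f) {j : κ} (hj : IsRecord y (f j)) : IsRecord (y ∘ f) j :=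
  fun k hk => hj (f k) (hf hk)

lemma fract_le_fract_of_notMem_Icc {x y : ℝ} (hx : x ∈ Set.Ico 0 1) (hy : y < 1)
    (hxy : x ≤ y + 1) (h : y ∉ Set.Icc 0 x) : Int.fract x ≤ Int.fract y := by
  rw [Int.fract_eq_self.2 hx]
  rcases lt_or_ge y 0 with hy0 | hy0
  · rwa [← Int.fract_add_one y, Int.fract_eq_self.2 ⟨hx.1.trans hxy, by linarith⟩]
  · rw [Int.fract_eq_self.2 ⟨hy0, hy⟩]
    exact (not_le.1 fun hyx => h ⟨hy0, hyx⟩).le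

section TreapAncestor

variable {X ι : Type*} {e : ι → X} {w g : X → ℝ} {i j : ι}

lemma IsTreapAncestor.isRecord [Preorder ι] (hw : StrictAnti fun j => w (e j))
    (hg : ∀ x, g x ∈ Set.Ioo 0 1) (h : IsTreapAncestor e w g i j) :
    IsRecord (fun k => Int.fract (g (e k) - g (e i))) j ∨
      IsRecord (fun k => Int.fract (g (e i) - g (e k))) j := by
  have hnotMem {k : ι} (hk : k < j) : g (e k) ∉ Set.uIcc (g (e j)) (g (e i)) :=
    fun hmem => (hw hk).not_ge (h k hmem)
  have hi := hg (e i)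
  have hj := hg (e j)
  rcases le_total (g (e i)) (g (e j)) with hij | hij
  · refine Or.inl fun k hk => fract_le_fract_of_notMem_Icc ⟨sub_nonneg.2 hij, ?_⟩ ?_ ?_ ?_
    · linarith [hi.1, hj.2]
    · linarith [hi.1, (hg (e k)).2]
    · linarith [hj.2, (hg (e k)).1]
    · rw [Set.sub_mem_Icc_iff_left, zero_add, sub_add_cancel, ← Set.uIcc_of_ge hij]
      exact hnotMem hk
  · refine Or.inr fun k hk => fract_le_fract_of_notMem_Icc ⟨sub_nonneg.2 hij, ?_⟩ ?_ ?_ ?_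
    · linarith [hi.2, hj.1]
    · linarith [hi.2, (hg (e k)).1]
    · linarith [hj.1, (hg (e k)).2]
    · rw [Set.sub_mem_Icc_iff_right, sub_sub_cancel, sub_zero, ← Set.uIcc_of_le hij]
      exact hnotMem hk

lemma IsTreapAncestor.priority_le (h : IsTreapAncestor e w g i j) : w (e i) ≤ w (e j) :=
  h i Set.right_mem_uIcc

lemma measurableSet_isTreapAncestor [Countable ι] {Ω : Type*} [MeasurableSpace Ω] {h : Ω → X → ℝ}
    (hh : ∀ x, Measurable fun ω => h ω x) (e : ι → X) (w : X → ℝ) (i j : ι) :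
    MeasurableSet {ω | IsTreapAncestor e w (h ω) i j} := by
  simp only [IsTreapAncestor, Set.ofPred_forall, Set.uIcc, Set.mem_Icc]
  refine .iInter fun k => ?_
  exact (((measurableSet_le ((hh _).inf (hh _)) (hh _)).inter
    (measurableSet_le (hh _) ((hh _).sup (hh _))))).imp (.const _)

end TreapAncestor

lemma sum_measureReal_isRecord_pivot_le {X Ω : Type*} [MeasurableSpace Ω] {μ : Measure Ω}
    [IsProbabilityMeasure μ] {h : Ω → X → ℝ} (hh : IsKWiseIndependentHash 4 μ h) {N : ℕ}
    (f : Fin N ↪ X) {x : X} (hx : x ∉ Set.range f) {g : ℝ → ℝ → ℝ}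
    (hg : Measurable (Function.uncurry g))
    (hgν : ∀ u, MeasurePreserving (g u) (volume.restrict (Set.Ioo 0 1))
      (volume.restrict (Set.Ioo 0 1))) :
    ∑ j, μ.real {ω | IsRecord (fun k => g (h ω x) (h ω (f k))) j} ≤
      4672 * Real.logb 2 (N + 1) := by
  have hunif : IsProbabilityMeasure (volume.restrict (Set.Ioo (0 : ℝ) 1)) := ⟨by simp⟩
  exact sum_measureReal_isRecord_le
    ((hh.isKWiseIndep.reindex (f.optionElim x hx)).comp_pivot (by norm_num) hg hgν)

lemma map_castLEEmb_univ {n : ℕ} (i : Fin n) :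
    Finset.univ.map (Fin.castLEEmb i.2.le) = Finset.Iio i := by
  ext j
  simp only [Finset.mem_map, Finset.mem_univ, true_and, Finset.mem_Iio]
  exact ⟨fun ⟨k, hk⟩ => hk ▸ k.2, fun hj => ⟨⟨j, hj⟩, rfl⟩⟩

lemma sum_eq_add_sum_castLE {M : Type*} [AddCommMonoid M] {n : ℕ} {f : Fin n → M} {i : Fin n}
    (hf : ∀ j > i, f j = 0) : ∑ j, f j = f i + ∑ j : Fin i, f (j.castLE i.2.le) := by
  rw [← Finset.sum_subset (Finset.subset_univ (Finset.Iic i)) fun j _ hj =>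
      hf j (not_le.1 fun h => hj (Finset.mem_Iic.2 h)),
    ← Finset.Iio_insert, Finset.sum_insert Finset.notMem_Iio_self, ← map_castLEEmb_univ,
    Finset.sum_map]
  rfl

theorem sum_measureReal_isTreapAncestor_le {X Ω : Type*} [MeasurableSpace Ω] {μ : Measure Ω}
    [IsProbabilityMeasure μ] {h : Ω → X → ℝ} (hh : IsKWiseIndependentHash 4 μ h) {n : ℕ}
    {e : Fin n → X} {w : X → ℝ} (hw : StrictAnti fun j => w (e j)) (i : Fin n) :
    ∑ j, μ.real {ω | IsTreapAncestor e w (h ω) i j} ≤ 1 + 9344 * Real.logb 2 ((i : ℕ) + 1) := by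
  have he : Function.Injective e := fun j k hjk => hw.injective (congrArg w hjk)
  have hlater : ∀ j > i, μ.real {ω | IsTreapAncestor e w (h ω) i j} = 0 := fun j hij => by
    have hnot (ω : Ω) : ¬IsTreapAncestor e w (h ω) i j :=
      fun hω => (hw hij).not_ge hω.priority_le
    simp only [hnot, Set.ofPred_false, measureReal_empty]
  let e' : Fin i ↪ X := (Fin.castLEEmb i.2.le).trans ⟨e, he⟩
  have hi : e i ∉ Set.range e' := by
    rintro ⟨j, hj⟩
    exact j.2.ne (congrArg Fin.val (he hj))
  have hrecord (j : Fin i) : μ.real {ω | IsTreapAncestor e w (h ω) i (j.castLE i.2.le)} ≤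
      μ.real {ω | IsRecord (fun k => Int.fract (h ω (e' k) - h ω (e i))) j} +
      μ.real {ω | IsRecord (fun k => Int.fract (h ω (e i) - h ω (e' k))) j} :=
    (measureReal_mono fun ω hω => (hω.isRecord hw (hh.mem_Ioo ω)).imp
      (IsRecord.comp_strictMono (Fin.strictMono_castLE i.2.le))
      (IsRecord.comp_strictMono (Fin.strictMono_castLE i.2.le))).trans
      (measureReal_union_le _ _)
  have hright := sum_measureReal_isRecord_pivot_le hh e' hi (g := fun u v => Int.fract (v - u))
    (measurable_fract.comp (measurable_snd.sub measurable_fst)) measurePreserving_fract_sub_right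
  have hleft := sum_measureReal_isRecord_pivot_le hh e' hi (g := fun u v => Int.fract (u - v))
    (measurable_fract.comp (measurable_fst.sub measurable_snd)) measurePreserving_fract_sub_left
  calc ∑ j, μ.real {ω | IsTreapAncestor e w (h ω) i j}
      = μ.real {ω | IsTreapAncestor e w (h ω) i i} +
          ∑ j : Fin i, μ.real {ω | IsTreapAncestor e w (h ω) i (j.castLE i.2.le)} :=
        sum_eq_add_sum_castLE hlater
    _ ≤ 1 + (4672 * Real.logb 2 ((i : ℕ) + 1) + 4672 * Real.logb 2 ((i : ℕ) + 1)) := by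
        refine add_le_add measureReal_le_one ((Finset.sum_le_sum fun j _ => hrecord j).trans ?_)
        rw [Finset.sum_add_distrib]
        exact add_le_add hright hleft
    _ = 1 + 9344 * Real.logb 2 ((i : ℕ) + 1) := by ring

theorem mainTheorem9 :
    ∃ C : ℝ, 0 < C ∧
      ∀ {X Ω : Type*} [MeasurableSpace Ω] (μ : Measure Ω) [IsProbabilityMeasure μ]
        (h : Ω → X → ℝ), IsKWiseIndependentHash 4 μ h →
      ∀ (n : ℕ) (e : Fin n → X) (w : X → ℝ), StrictAnti (fun j => w (e j)) →
      ∀ T : Ω → PTree, (∀ᵐ ω ∂μ, IsLearnedTreap e w (h ω) (T ω)) →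
      ∀ i : Fin n,
        Integrable (fun ω => (PTree.depth (h ω (e i)) (T ω) : ℝ)) μ ∧
        ∫ ω, (PTree.depth (h ω (e i)) (T ω) : ℝ) ∂μ ≤ 1 + C * Real.log ((i : ℕ) + 1) := by
  classical
  refine ⟨9344 / Real.log 2, by positivity, fun μ _ h hh n e w hw T hT i => ?_⟩
  have hdepth : (fun ω => (PTree.depth (h ω (e i)) (T ω) : ℝ)) =ᵐ[μ]
      fun ω => ((Finset.univ.filter fun j => IsTreapAncestor e w (h ω) i j).card : ℝ) := by
    filter_upwards [hT] with ω hω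
    rw [hω.depth_eq hw.injective]
  have hmeas : ∀ j ∈ Finset.univ, MeasurableSet {ω | IsTreapAncestor e w (h ω) i j} :=
    fun j _ => measurableSet_isTreapAncestor hh.measurable e w i j
  refine ⟨(integrable_card_filter _ hmeas).congr hdepth.symm, ?_⟩
  calc ∫ ω, (PTree.depth (h ω (e i)) (T ω) : ℝ) ∂μ
      = ∑ j, μ.real {ω | IsTreapAncestor e w (h ω) i j} := by
        rw [integral_congr_ae hdepth, integral_card_filter _ hmeas]
    _ ≤ 1 + 9344 * Real.logb 2 ((i : ℕ) + 1) := sum_measureReal_isTreapAncestor_le hh hw i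
    _ = 1 + 9344 / Real.log 2 * Real.log ((i : ℕ) + 1) := by
        rw [Real.logb, mul_div_assoc', div_mul_eq_mul_div]
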